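/- Let $d\ge 1$, $\mathbb R^d_+=(0,\infty)^d$ with the Euclidean norm $\|\cdot\|$, $e=(d^{-1/2},\dots,d^{-1/2})$, and $S_+=\{x\in\mathbb R^d_+:\|x\|=1\}$. "Measurable" means Borel measurable. A measurable function $f:\mathbb R^d_+\to(0,\infty)$ is called radially regularly varying if for every $x\in\mathbb R^d_+$ the limit $\lim_{t\to\infty} f(tx)/f(te)=\varphi(x)$ exists and $\varphi(x)\in(0,\infty)$. A measurable function $L:\mathbb R^d_+\to[0,\infty)$ is called radially slowly varying if there is a function $\lambda:S_+\to[0,\infty)$ with $\lambda(e)=1$ such that, for every $x\in\mathbb R^d_+$, $\lim_{t\to\infty}L(tx)/L(te)=\lambda(x/\|x\|)$, and $L(x)=0$ if and only if $\lambda(x/\|x\|)=0$. (For positive $L$ the last condition says that $\lambda$ is positive.) A measurable function $l:(0,\infty)\to(0,\infty)$ is called slowly varying if $\lim_{t\to\infty}l(ct)/l(t)=1$ for every $c>0$. (1) If $f:\mathbb R^d_+\to(0,\infty)$ is radially regularly varying, then there are $\rho\in\mathbb R$ and a radially slowly varying $L$ such that $f(x)=\|x\|^{\rho}L(x)$ for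 all $x\in\mathbb R^d_+$. (2) A measurable function $L:\mathbb R^d_+\to\mathbb R$ is radially slowly varying if and only if $$L(x)=K(x)\,l(\|x\|)\,\lambda(x/\|x\|),\qquad x\in\mathbb R^d_+,$$ for some slowly varying $l:(0,\infty)\to(0,\infty)$, some $\lambda:S_+\to[0,\infty)$ with $\lambda(e)>0$, and some positive function $K$ of the form $$K(x)=\exp\Big(\eta(x)+\int_a^{\|x\|}\frac{\varepsilon(u)}{u}\,du\Big),\qquad x\in\mathbb R^d_+,$$ where $a>0$; $\eta:\mathbb R^d_+\to\mathbb R$ is a function for which there is a constant $C\in\mathbb R$ with $\lim_{t\to\infty}\eta(tx)=C$ for every $x\in\mathbb R^d_+$; and $\varepsilon$ is a real function on $(0,\infty)$, with $\varepsilon(u)/u$ integrable on every compact subinterval of $(0,\infty)$, such that $\varepsilon(t)=o(t^{-k})$ as $t\to\infty$ for every $k\ge 0$. -/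

import Mathlib

open Filter Topology MeasureTheory Asymptotics

noncomputable section

namespace RadialVariation

/-- The open orthant `(0, ∞)^d` in Euclidean space. -/
def orthant (d : ℕ) : Set (EuclideanSpace ℝ (Fin d)) := {x | ∀ i, 0 < x i}

/-- The reference direction `e = (d^{-1/2}, …, d^{-1/2})`. -/
def diagDir (d : ℕ) : EuclideanSpace ℝ (Fin d) :=
  WithLp.toLp 2 fun _ => (Real.sqrt (d : ℝ))⁻¹

/-- The direction `x / ‖x‖` of a vector. -/
def dir {d : ℕ} (x : EuclideanSpace ℝ (Fin d)) : EuclideanSpace ℝ (Fin d) := ‖x‖⁻¹ • x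

/-- The part of the unit sphere that lies in the open orthant. -/
def spherePart (d : ℕ) : Set (EuclideanSpace ℝ (Fin d)) := {a | a ∈ orthant d ∧ ‖a‖ = 1}

/-- Radially regularly varying functions `(0, ∞)^d → (0, ∞)`. Only the values of `f` on the
orthant matter. -/
def IsRadiallyRegularlyVarying {d : ℕ} (f : EuclideanSpace ℝ (Fin d) → ℝ) : Prop :=
  Measurable ((orthant d).domRestrict f) ∧
  (∀ x ∈ orthant d, 0 < f x) ∧
  ∃ φ : EuclideanSpace ℝ (Fin d) → ℝ, ∀ x ∈ orthant d,
    0 < φ x ∧ Tendsto (fun t : ℝ => f (t • x) / f (t • diagDir d)) atTop (𝓝 (φ x))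

/-- The defining relation of radial slow variation with limit function `lam`: `lam` is non-negative
on the part of the unit sphere in the orthant, `lam e = 1`, and
`L (t x) / L (t e) → lam (x / ‖x‖)` as `t → ∞`, for every `x` in the orthant. -/
def IsRadialLimit {d : ℕ} (L lam : EuclideanSpace ℝ (Fin d) → ℝ) : Prop :=
  (∀ a ∈ spherePart d, 0 ≤ lam a) ∧
  lam (diagDir d) = 1 ∧
  ∀ x ∈ orthant d,
    Tendsto (fun t : ℝ => L (t • x) / L (t • diagDir d)) atTop (𝓝 (lam (dir x)))

/-- Radially slowly varying functions `(0, ∞)^d → [0, ∞)`. The last clause says that `L` vanishes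
exactly on the rays on which the limit function vanishes; for a positive `L` it says that the limit
function is positive. -/
def IsRadiallySlowlyVarying {d : ℕ} (L : EuclideanSpace ℝ (Fin d) → ℝ) : Prop :=
  Measurable ((orthant d).domRestrict L) ∧
  (∀ x ∈ orthant d, 0 ≤ L x) ∧
  ∃ lam : EuclideanSpace ℝ (Fin d) → ℝ, IsRadialLimit L lam ∧
    ∀ x ∈ orthant d, (L x = 0 ↔ lam (dir x) = 0)

/-- Univariate (Karamata) slowly varying functions `(0, ∞) → (0, ∞)`. -/
def IsSlowlyVarying (l : ℝ → ℝ) : Prop :=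
  Measurable ((Set.Ioi (0 : ℝ)).domRestrict l) ∧
  (∀ t : ℝ, 0 < t → 0 < l t) ∧
  ∀ c : ℝ, 0 < c → Tendsto (fun t : ℝ => l (c * t) / l t) atTop (𝓝 1)

/-- The representation `K x = exp (η x + ∫_a^{‖x‖} ε(u)/u du)` on the orthant, where `a > 0`,
`η` tends to one real constant `C` along every ray, and `ε(t) = o(t^{-k})` as `t → ∞` for every
`k ≥ 0`. -/
def HasExpIntegralRep {d : ℕ} (K : EuclideanSpace ℝ (Fin d) → ℝ) : Prop :=
  ∃ (a C : ℝ) (η : EuclideanSpace ℝ (Fin d) → ℝ) (ε : ℝ → ℝ),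
    0 < a ∧
    (∀ x ∈ orthant d, Tendsto (fun t : ℝ => η (t • x)) atTop (𝓝 C)) ∧
    (∀ k : ℝ, 0 ≤ k → ε =o[atTop] fun t : ℝ => t ^ (-k)) ∧
    (∀ b : ℝ, 0 < b → IntervalIntegrable (fun u => ε u / u) volume a b) ∧
    ∀ x ∈ orthant d, K x = Real.exp (η x + ∫ u in a..‖x‖, ε u / u)

end RadialVariation

end

/-!
Along the ray of the reference vector `e`, the limit function of a radially regularly varying `f` is
multiplicative and measurable, so Cauchy's functional equation makes it a power `c ^ ρ`. Dividing
`f` by `‖x‖ ^ ρ` leaves a limit function that depends on the direction alone.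

For a radially slowly varying `L`, the function `l t = L (t e)` is slowly varying, and the logarithm
of `L x / (l ‖x‖ λ(x/‖x‖))` tends to `0` along every ray, which gives a representation with `ε = 0`.
Conversely, a product `K x l ‖x‖ λ(x/‖x‖)` is radially slowly varying as soon as
`K (t x) / K (t e) → 1`. An exponential integral has this property once `ε → 0`, because the
integral of `ε u / u` over `[t, t c]` is at most `sup |ε| · |log c|`.

The orthant enters only as a cone without apex, and its Euclidean space as a real normed space.
-/

namespace RadialVariation

open NormedSpace (normalize norm_smul_normalize norm_normalize normalize_smul_of_pos
  normalize_normalize normalize_eq_self_of_norm_eq_one)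

lemma tendsto_smul_smul_div {E : Type*} [AddCommGroup E] [Module ℝ E] {f : E → ℝ} {e x : E}
    {c α β : ℝ} (hne : ∀ t : ℝ, 0 < t → f (t • e) ≠ 0) (hc : 0 < c)
    (hx : Tendsto (fun t : ℝ => f (t • x) / f (t • e)) atTop (𝓝 α))
    (he : Tendsto (fun t : ℝ => f (t • c • e) / f (t • e)) atTop (𝓝 β)) :
    Tendsto (fun t : ℝ => f (t • c • x) / f (t • e)) atTop (𝓝 (α * β)) := by
  have hcx : Tendsto (fun t : ℝ => f (t • c • x) / f (t • c • e)) atTop (𝓝 α) := by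
    simpa only [Function.comp_def, id, mul_smul] using hx.comp (tendsto_id.atTop_mul_const hc)
  refine (hcx.mul he).congr' ?_
  filter_upwards [eventually_gt_atTop 0] with t ht
  exact div_mul_div_cancel₀ (by simpa only [mul_smul] using hne _ (mul_pos ht hc))

section Univariate

lemma exists_eq_rpow_of_map_mul {ψ : ℝ → ℝ} (hmeas : Measurable ((Set.Ioi (0 : ℝ)).domRestrict ψ))
    (hpos : ∀ c, 0 < c → 0 < ψ c) (hmul : ∀ b c, 0 < b → 0 < c → ψ (b * c) = ψ b * ψ c) :
    ∃ ρ : ℝ, ∀ c, 0 < c → ψ c = c ^ ρ := by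
  let logψ : ℝ →+ ℝ := AddMonoidHom.mk' (fun u => Real.log (ψ (Real.exp u))) fun u v => by
    rw [Real.exp_add, hmul _ _ u.exp_pos v.exp_pos,
      Real.log_mul (hpos _ u.exp_pos).ne' (hpos _ v.exp_pos).ne']
  have hlogψ_meas : Measurable logψ :=
    Real.measurable_log.comp (hmeas.comp (Real.measurable_exp.subtype_mk (h := Real.exp_pos)))
  have hlogψ_cont : Continuous logψ :=
    MeasureTheory.Measure.AddMonoidHom.continuous_of_measurable logψ hlogψ_meas
  refine ⟨logψ 1, fun c hc => ?_⟩
  have hlinear : Real.log (ψ c) = Real.log c * logψ 1 := by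
    have h := map_real_smul logψ hlogψ_cont (Real.log c) 1
    simpa [logψ, Real.exp_log hc] using h
  rw [Real.rpow_def_of_pos hc, ← hlinear, Real.exp_log (hpos c hc)]

lemma measurable_of_tendsto_div {g ψ : ℝ → ℝ} (hg : Measurable ((Set.Ioi (0 : ℝ)).domRestrict g))
    (hlim : ∀ c, 0 < c → Tendsto (fun t => g (t * c) / g t) atTop (𝓝 (ψ c))) :
    Measurable ((Set.Ioi (0 : ℝ)).domRestrict ψ) := by
  have hsucc : Tendsto (fun n : ℕ => (n : ℝ) + 1) atTop atTop :=
    tendsto_atTop_add_const_right _ _ tendsto_natCast_atTop_atTop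
  refine measurable_of_tendsto_metrizable
    (f := fun (n : ℕ) (c : Set.Ioi (0 : ℝ)) => g ((n + 1) * c) / g (n + 1)) (fun n => ?_)
    (tendsto_pi_nhds.2 fun c => (hlim c c.2).comp hsucc)
  have hscale : Measurable fun c : Set.Ioi (0 : ℝ) =>
      (⟨(n + 1) * c, Set.mem_Ioi.2 (mul_pos n.cast_add_one_pos c.2)⟩ : Set.Ioi (0 : ℝ)) :=
    (measurable_subtype_coe.const_mul _).subtype_mk
  exact (hg.comp hscale).div_const _

/-- Karamata's characterization theorem. -/
theorem exists_eq_rpow_of_tendsto_div {g ψ : ℝ → ℝ}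
    (hg : Measurable ((Set.Ioi (0 : ℝ)).domRestrict g)) (hne : ∀ t, 0 < t → g t ≠ 0)
    (hpos : ∀ c, 0 < c → 0 < ψ c)
    (hlim : ∀ c, 0 < c → Tendsto (fun t => g (t * c) / g t) atTop (𝓝 (ψ c))) :
    ∃ ρ : ℝ, ∀ c, 0 < c → ψ c = c ^ ρ := by
  refine exists_eq_rpow_of_map_mul (measurable_of_tendsto_div hg hlim) hpos fun b c hb hc => ?_
  have hprod := tendsto_smul_smul_div (f := g) (e := 1) (x := c) (c := b) (α := ψ c) (β := ψ b)
    (by simpa using hne) hb (by simpa using hlim c hc) (by simpa using hlim b hb)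
  rw [mul_comm (ψ b)]
  exact tendsto_nhds_unique (hlim _ (mul_pos hb hc)) (by simpa using hprod)

lemma norm_integral_div_le_of_norm_le {ε : ℝ → ℝ} {κ s t : ℝ} (hs : 0 < s) (ht : 0 < t)
    (hε : ∀ u ∈ Set.uIoc s t, ‖ε u‖ ≤ κ) :
    ‖∫ u in s..t, ε u / u‖ ≤ |κ * Real.log (t / s)| := by
  have hbound : ∀ u ∈ Set.uIoc s t, ‖ε u / u‖ ≤ κ * u⁻¹ := fun u hu => by
    have hu0 : 0 < u := (lt_min hs ht).trans hu.1
    rw [norm_div, Real.norm_of_nonneg hu0.le, div_eq_mul_inv]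
    gcongr
    exact hε u hu
  have hintegrable : IntervalIntegrable (fun u : ℝ => κ * u⁻¹) volume s t :=
    (intervalIntegrable_inv_iff.2 (.inr (Set.notMem_uIcc_of_lt hs ht))).const_mul κ
  refine (intervalIntegral.norm_integral_le_abs_of_norm_le
    (ae_restrict_of_forall_mem measurableSet_uIoc hbound) hintegrable).trans_eq ?_
  rw [intervalIntegral.integral_const_mul, integral_inv_of_pos hs ht]

lemma tendsto_integral_div_of_tendsto_zero {ε : ℝ → ℝ} (hε : Tendsto ε atTop (𝓝 0)) {c : ℝ}
    (hc : 0 < c) : Tendsto (fun t : ℝ => ∫ u in t..t * c, ε u / u) atTop (𝓝 0) := by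
  have hlittle : (fun t : ℝ => ∫ u in t..t * c, ε u / u) =o[atTop] fun _ => Real.log c := by
    refine isLittleO_iff.2 fun κ hκ => ?_
    obtain ⟨N, hN⟩ := eventually_atTop.1 (((isLittleO_one_iff ℝ).2 hε).bound hκ)
    filter_upwards [eventually_gt_atTop 0, eventually_ge_atTop N,
      (tendsto_id.atTop_mul_const hc).eventually_ge_atTop N] with t ht hNt hNtc
    have hεκ : ∀ u ∈ Set.uIoc t (t * c), ‖ε u‖ ≤ κ := fun u hu => by
      simpa using hN u ((le_min hNt hNtc).trans hu.1.le)
    have h := norm_integral_div_le_of_norm_le ht (mul_pos ht hc) hεκ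
    rwa [mul_div_cancel_left₀ c ht.ne', abs_mul, abs_of_pos hκ] at h
  exact (isLittleO_one_iff ℝ).1 (hlittle.trans_isBigO (isBigO_const_const _ one_ne_zero _))

end Univariate

section Cone

variable {E : Type*} [NormedAddCommGroup E] [NormedSpace ℝ E] {S : Set E} {e : E}

/-- A cone without apex, together with the unit vector `e` in it that serves as the reference
direction. The cone need not be convex or open. -/
structure IsBasedCone (S : Set E) (e : E) : Prop where
  smul_mem : ∀ ⦃x⦄, x ∈ S → ∀ ⦃t : ℝ⦄, 0 < t → t • x ∈ S
  zero_notMem : 0 ∉ S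
  base_mem : e ∈ S
  norm_base : ‖e‖ = 1

/-- Radial regular variation on a cone `S` with reference direction `e`; for the orthant and
`diagDir` this is `IsRadiallyRegularlyVarying`. -/
def IsRadiallyRegularlyVaryingOn [MeasurableSpace E] (S : Set E) (e : E) (f : E → ℝ) : Prop :=
  Measurable (S.domRestrict f) ∧
  (∀ x ∈ S, 0 < f x) ∧
  ∃ φ : E → ℝ, ∀ x ∈ S,
    0 < φ x ∧ Tendsto (fun t : ℝ => f (t • x) / f (t • e)) atTop (𝓝 (φ x))

/-- The limit relation of radial slow variation on a cone `S` with reference direction `e`; for the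
orthant and `diagDir` this is `IsRadialLimit`. -/
def IsRadialLimitOn (S : Set E) (e : E) (L lam : E → ℝ) : Prop :=
  (∀ a, a ∈ S ∧ ‖a‖ = 1 → 0 ≤ lam a) ∧
  lam e = 1 ∧
  ∀ x ∈ S, Tendsto (fun t : ℝ => L (t • x) / L (t • e)) atTop (𝓝 (lam (normalize x)))

/-- Radial slow variation on a cone `S` with reference direction `e`; for the orthant and `diagDir`
this is `IsRadiallySlowlyVarying`. -/
def IsRadiallySlowlyVaryingOn [MeasurableSpace E] (S : Set E) (e : E) (L : E → ℝ) : Prop :=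
  Measurable (S.domRestrict L) ∧
  (∀ x ∈ S, 0 ≤ L x) ∧
  ∃ lam : E → ℝ, IsRadialLimitOn S e L lam ∧ ∀ x ∈ S, (L x = 0 ↔ lam (normalize x) = 0)

/-- A factorization `L x = K x * l ‖x‖ * lam (x / ‖x‖)` on the cone `S` into a correction `K`, a
slowly varying radial part `l` and a directional part `lam`. No condition is put on `K` here. -/
def IsRadialFactorization (S : Set E) (e : E) (L K : E → ℝ) (l : ℝ → ℝ) (lam : E → ℝ) : Prop :=
  IsSlowlyVarying l ∧
  (∀ a, a ∈ S ∧ ‖a‖ = 1 → 0 ≤ lam a) ∧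
  0 < lam e ∧
  ∀ x ∈ S, L x = K x * l ‖x‖ * lam (normalize x)

/-- Positive functions on the cone `S` that are asymptotically the same along all its rays: the
property of the correction `K` in a factorization that makes the product radially slowly varying. -/
def IsAsymptoticallyRadial (S : Set E) (e : E) (K : E → ℝ) : Prop :=
  (∀ x ∈ S, 0 < K x) ∧
  ∀ x ∈ S, Tendsto (fun t : ℝ => K (t • x) / K (t • e)) atTop (𝓝 1)

namespace IsBasedCone

lemma ne_zero (hS : IsBasedCone S e) {x : E} (hx : x ∈ S) : x ≠ 0 :=
  ne_of_mem_of_not_mem hx hS.zero_notMem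

lemma norm_pos (hS : IsBasedCone S e) {x : E} (hx : x ∈ S) : 0 < ‖x‖ :=
  norm_pos_iff.2 (hS.ne_zero hx)

lemma normalize_mem (hS : IsBasedCone S e) {x : E} (hx : x ∈ S) : normalize x ∈ S :=
  hS.smul_mem hx (inv_pos.2 (hS.norm_pos hx))

lemma smul_base_mem (hS : IsBasedCone S e) {t : ℝ} (ht : 0 < t) : t • e ∈ S :=
  hS.smul_mem hS.base_mem ht

lemma norm_smul_base (hS : IsBasedCone S e) {t : ℝ} (ht : 0 < t) : ‖t • e‖ = t := by
  rw [norm_smul_of_nonneg ht.le, hS.norm_base, mul_one]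

lemma normalize_smul_base (hS : IsBasedCone S e) {t : ℝ} (ht : 0 < t) :
    normalize (t • e) = e := by
  rw [normalize_smul_of_pos ht, normalize_eq_self_of_norm_eq_one hS.norm_base]

end IsBasedCone

lemma measurable_comp_smul [MeasurableSpace E] [BorelSpace E] {f : E → ℝ} {x : E}
    (hf : Measurable (S.domRestrict f)) (hx : ∀ t : ℝ, 0 < t → t • x ∈ S) :
    Measurable ((Set.Ioi (0 : ℝ)).domRestrict fun t => f (t • x)) := by
  have hray : Measurable fun t : Set.Ioi (0 : ℝ) => (⟨(t : ℝ) • x, hx t t.2⟩ : S) :=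
    (measurable_subtype_coe.smul_const x).subtype_mk
  exact hf.comp hray

section RegularVariation

variable {f φ : E → ℝ}

lemma exists_limit_smul_eq_mul_rpow [MeasurableSpace E] [BorelSpace E] (hS : IsBasedCone S e)
    (hf : Measurable (S.domRestrict f)) (hpos : ∀ x ∈ S, 0 < f x) (hφpos : ∀ x ∈ S, 0 < φ x)
    (hφ : ∀ x ∈ S, Tendsto (fun t : ℝ => f (t • x) / f (t • e)) atTop (𝓝 (φ x))) :
    ∃ ρ : ℝ, ∀ x ∈ S, ∀ c : ℝ, 0 < c → φ (c • x) = φ x * c ^ ρ := by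
  have hne : ∀ t : ℝ, 0 < t → f (t • e) ≠ 0 := fun t ht => (hpos _ (hS.smul_base_mem ht)).ne'
  obtain ⟨ρ, hρ⟩ := exists_eq_rpow_of_tendsto_div (g := fun t => f (t • e))
    (ψ := fun c => φ (c • e)) (measurable_comp_smul hf fun _ => hS.smul_base_mem) hne
    (fun c hc => hφpos _ (hS.smul_base_mem hc))
    fun c hc => by simpa only [mul_smul] using hφ _ (hS.smul_base_mem hc)
  refine ⟨ρ, fun x hx c hc => ?_⟩
  rw [← hρ c hc]
  exact tendsto_nhds_unique (hφ _ (hS.smul_mem hx hc))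
    (tendsto_smul_smul_div hne hc (hφ x hx) (hφ _ (hS.smul_base_mem hc)))

lemma isRadialLimitOn_div_norm_rpow {ρ : ℝ} (hS : IsBasedCone S e) (hφpos : ∀ x ∈ S, 0 < φ x)
    (hφ : ∀ x ∈ S, Tendsto (fun t : ℝ => f (t • x) / f (t • e)) atTop (𝓝 (φ x)))
    (hne : ∀ t : ℝ, 0 < t → f (t • e) ≠ 0)
    (hρ : ∀ x ∈ S, ∀ c : ℝ, 0 < c → φ (c • x) = φ x * c ^ ρ) :
    IsRadialLimitOn S e (fun x => f x / ‖x‖ ^ ρ) φ := by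
  refine ⟨fun a ha => (hφpos a ha.1).le, ?_, fun x hx => ?_⟩
  · refine tendsto_nhds_unique (hφ e hS.base_mem) (tendsto_const_nhds.congr' ?_)
    filter_upwards [eventually_gt_atTop 0] with t ht
    exact (div_self (hne t ht)).symm
  have hx0 := hS.norm_pos hx
  have hφnormalize : φ x / ‖x‖ ^ ρ = φ (normalize x) := by
    rw [NormedSpace.normalize, hρ x hx _ (inv_pos.2 hx0), Real.inv_rpow hx0.le, div_eq_mul_inv]
  rw [← hφnormalize]
  refine ((hφ x hx).div_const _).congr' ?_
  filter_upwards [eventually_gt_atTop 0] with t ht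
  have hnorm : ‖t • x‖ ^ ρ / ‖t • e‖ ^ ρ = ‖x‖ ^ ρ := by
    rw [hS.norm_smul_base ht, norm_smul_of_nonneg ht.le, Real.mul_rpow ht.le hx0.le,
      mul_div_cancel_left₀ _ (Real.rpow_pos_of_pos ht ρ).ne']
  rw [div_div_div_comm, hnorm]

theorem IsRadiallyRegularlyVaryingOn.exists_eq_rpow_mul [MeasurableSpace E] [BorelSpace E]
    (hS : IsBasedCone S e) (hf : IsRadiallyRegularlyVaryingOn S e f) :
    ∃ (ρ : ℝ) (L : E → ℝ), IsRadiallySlowlyVaryingOn S e L ∧ ∀ x ∈ S, f x = ‖x‖ ^ ρ * L x := by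
  obtain ⟨hmeas, hpos, φ, hφ⟩ := hf
  obtain ⟨hφpos, hφlim⟩ := forall₂_and.1 hφ
  obtain ⟨ρ, hρ⟩ := exists_limit_smul_eq_mul_rpow hS hmeas hpos hφpos hφlim
  have hnorm : ∀ x ∈ S, 0 < ‖x‖ ^ ρ := fun x hx => Real.rpow_pos_of_pos (hS.norm_pos hx) ρ
  have hLpos : ∀ x ∈ S, 0 < f x / ‖x‖ ^ ρ := fun x hx => div_pos (hpos x hx) (hnorm x hx)
  have hlim : IsRadialLimitOn S e (fun x => f x / ‖x‖ ^ ρ) φ :=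
    isRadialLimitOn_div_norm_rpow hS hφpos hφlim
      (fun t ht => (hpos _ (hS.smul_base_mem ht)).ne') hρ
  exact ⟨ρ, fun x => f x / ‖x‖ ^ ρ,
    ⟨hmeas.div (measurable_subtype_coe.norm.pow_const ρ), fun x hx => (hLpos x hx).le, φ, hlim,
      fun x hx => iff_of_false (hLpos x hx).ne' (hφpos _ (hS.normalize_mem hx)).ne'⟩,
    fun x hx => (mul_div_cancel₀ _ (hnorm x hx).ne').symm⟩

end RegularVariation

section SlowVariation

variable {L K lam η : E → ℝ} {l ε : ℝ → ℝ}

lemma base_pos_of_eq_zero_iff (hS : IsBasedCone S e) (hL : ∀ x ∈ S, 0 ≤ L x) (hlam : lam e ≠ 0)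
    (hzero : ∀ x ∈ S, (L x = 0 ↔ lam (normalize x) = 0)) {t : ℝ} (ht : 0 < t) : 0 < L (t • e) := by
  have hte := hS.smul_base_mem ht
  refine (hL _ hte).lt_of_ne' ((hzero _ hte).not.2 ?_)
  rwa [hS.normalize_smul_base ht]

namespace IsRadialLimitOn

lemma isSlowlyVarying_base [MeasurableSpace E] [BorelSpace E] (hS : IsBasedCone S e)
    (hlim : IsRadialLimitOn S e L lam) (hL : Measurable (S.domRestrict L))
    (hpos : ∀ t : ℝ, 0 < t → 0 < L (t • e)) : IsSlowlyVarying fun t => L (t • e) := by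
  refine ⟨measurable_comp_smul hL fun _ => hS.smul_base_mem, hpos, fun c hc => ?_⟩
  have h := hlim.2.2 _ (hS.smul_base_mem hc)
  rw [hS.normalize_smul_base hc, hlim.2.1] at h
  simpa only [smul_smul, mul_comm c] using h

lemma tendsto_div_norm_smul_base (hS : IsBasedCone S e) (hlim : IsRadialLimitOn S e L lam) {x : E}
    (hx : x ∈ S) :
    Tendsto (fun t : ℝ => L (t • x) / L (‖t • x‖ • e)) atTop (𝓝 (lam (normalize x))) := by
  have h := (hlim.2.2 _ (hS.normalize_mem hx)).comp
    (tendsto_id.atTop_mul_const (hS.norm_pos hx))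
  rw [normalize_normalize] at h
  refine h.congr' ?_
  filter_upwards [eventually_gt_atTop 0] with t ht
  simp only [Function.comp_apply, id, norm_smul_of_nonneg ht.le, mul_smul t ‖x‖ (normalize x),
    norm_smul_normalize]

end IsRadialLimitOn

/-- The logarithm of the correction that turns `L (‖x‖ e) lam (x / ‖x‖)` into `L x`. It is `0` on
the rays on which `lam` vanishes, because `x / 0 = 0` and `log 0 = 0`. -/
noncomputable def logCorrection (e : E) (L lam : E → ℝ) (x : E) : ℝ :=
  Real.log (L x / L (‖x‖ • e) / lam (normalize x))

lemma IsRadialLimitOn.tendsto_logCorrection (hS : IsBasedCone S e)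
    (hlim : IsRadialLimitOn S e L lam) {x : E} (hx : x ∈ S) :
    Tendsto (fun t : ℝ => logCorrection e L lam (t • x)) atTop (𝓝 0) := by
  have hconst : ∀ᶠ t : ℝ in atTop, Real.log (L (t • x) / L (‖t • x‖ • e) / lam (normalize x)) =
      logCorrection e L lam (t • x) := by
    filter_upwards [eventually_gt_atTop 0] with t ht
    rw [logCorrection, normalize_smul_of_pos ht]
  refine Tendsto.congr' hconst ?_
  obtain hzero | hne := eq_or_ne (lam (normalize x)) 0
  · simp [hzero]
  · have h := (hlim.tendsto_div_norm_smul_base hS hx).div_const (lam (normalize x))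
    rw [div_self hne] at h
    simpa using h.log one_ne_zero

lemma eq_exp_logCorrection_mul {x : E} (hL : 0 ≤ L x) (hbase : 0 < L (‖x‖ • e))
    (hlam : 0 ≤ lam (normalize x)) (hzero : L x = 0 ↔ lam (normalize x) = 0) :
    L x = Real.exp (logCorrection e L lam x) * L (‖x‖ • e) * lam (normalize x) := by
  obtain h0 | hne := eq_or_ne (lam (normalize x)) 0
  · rw [h0, mul_zero, hzero, h0]
  · have hlampos : 0 < lam (normalize x) := hlam.lt_of_ne' hne
    have hLpos : 0 < L x := hL.lt_of_ne' (hzero.not.2 hne)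
    rw [logCorrection, Real.exp_log (div_pos (div_pos hLpos hbase) hlampos)]
    field_simp

theorem IsRadiallySlowlyVaryingOn.exists_isRadialFactorization_exp [MeasurableSpace E]
    [BorelSpace E] (hS : IsBasedCone S e) (hL : IsRadiallySlowlyVaryingOn S e L) :
    ∃ (η : E → ℝ) (l : ℝ → ℝ) (lam : E → ℝ),
      (∀ x ∈ S, Tendsto (fun t : ℝ => η (t • x)) atTop (𝓝 0)) ∧
      IsRadialFactorization S e L (fun x => Real.exp (η x)) l lam := by
  obtain ⟨hmeas, hnonneg, lam, hlim, hzero⟩ := hL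
  have hlame : 0 < lam e := hlim.2.1 ▸ one_pos
  have hbase : ∀ t : ℝ, 0 < t → 0 < L (t • e) := fun _ =>
    base_pos_of_eq_zero_iff hS hnonneg hlame.ne' hzero
  exact ⟨logCorrection e L lam, fun t => L (t • e), lam,
    fun x hx => hlim.tendsto_logCorrection hS hx,
    hlim.isSlowlyVarying_base hS hmeas hbase, hlim.1, hlame,
    fun x hx => eq_exp_logCorrection_mul (hnonneg x hx) (hbase _ (hS.norm_pos hx))
      (hlim.1 _ ⟨hS.normalize_mem hx, norm_normalize (hS.ne_zero hx)⟩) (hzero x hx)⟩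

lemma isAsymptoticallyRadial_of_eq_exp_add_integral {a C : ℝ} (hS : IsBasedCone S e)
    (hη : ∀ x ∈ S, Tendsto (fun t : ℝ => η (t • x)) atTop (𝓝 C)) (hε : Tendsto ε atTop (𝓝 0))
    (hint : ∀ b : ℝ, 0 < b → IntervalIntegrable (fun u => ε u / u) volume a b)
    (hK : ∀ x ∈ S, K x = Real.exp (η x + ∫ u in a..‖x‖, ε u / u)) :
    IsAsymptoticallyRadial S e K := by
  refine ⟨fun x hx => hK x hx ▸ Real.exp_pos _, fun x hx => ?_⟩
  have hx0 := hS.norm_pos hx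
  have hlim : Tendsto (fun t : ℝ =>
      Real.exp (η (t • x) - η (t • e) + ∫ u in t..t * ‖x‖, ε u / u)) atTop (𝓝 1) := by
    simpa using (((hη x hx).sub (hη e hS.base_mem)).add
      (tendsto_integral_div_of_tendsto_zero hε hx0)).rexp
  refine hlim.congr' ?_
  filter_upwards [eventually_gt_atTop 0] with t ht
  rw [hK _ (hS.smul_mem hx ht), hK _ (hS.smul_base_mem ht), ← Real.exp_sub,
    hS.norm_smul_base ht, norm_smul_of_nonneg ht.le, add_sub_add_comm,
    intervalIntegral.integral_interval_sub_left (hint _ (mul_pos ht hx0)) (hint t ht)]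

lemma isAsymptoticallyRadial_exp {C : ℝ} (hS : IsBasedCone S e)
    (hη : ∀ x ∈ S, Tendsto (fun t : ℝ => η (t • x)) atTop (𝓝 C)) :
    IsAsymptoticallyRadial S e fun x => Real.exp (η x) :=
  isAsymptoticallyRadial_of_eq_exp_add_integral (a := 1) (ε := 0) hS hη tendsto_const_nhds
    (by simp) (by simp)

theorem IsRadialFactorization.isRadiallySlowlyVaryingOn [MeasurableSpace E]
    (hS : IsBasedCone S e) (hL : Measurable (S.domRestrict L)) (hK : IsAsymptoticallyRadial S e K)
    (hfact : IsRadialFactorization S e L K l lam) : IsRadiallySlowlyVaryingOn S e L := by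
  obtain ⟨hKpos, hKlim⟩ := hK
  obtain ⟨⟨-, hlpos, hllim⟩, hlam, hlame, hprod⟩ := hfact
  have hKl : ∀ x ∈ S, 0 < K x * l ‖x‖ := fun x hx =>
    mul_pos (hKpos x hx) (hlpos _ (hS.norm_pos hx))
  refine ⟨hL, fun x hx => ?_, fun a => lam a / lam e,
    ⟨fun a ha => div_nonneg (hlam a ha) hlame.le, div_self hlame.ne', fun x hx => ?_⟩,
    fun x hx => ?_⟩
  · rw [hprod x hx]
    exact mul_nonneg (hKl x hx).le
      (hlam _ ⟨hS.normalize_mem hx, norm_normalize (hS.ne_zero hx)⟩)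
  · have hlim : Tendsto (fun t : ℝ => K (t • x) / K (t • e) * (l (‖x‖ * t) / l t) *
        (lam (normalize x) / lam e)) atTop (𝓝 (lam (normalize x) / lam e)) := by
      simpa using ((hKlim x hx).mul (hllim _ (hS.norm_pos hx))).mul_const
        (lam (normalize x) / lam e)
    refine hlim.congr' ?_
    filter_upwards [eventually_gt_atTop 0] with t ht
    rw [hprod _ (hS.smul_mem hx ht), hprod _ (hS.smul_base_mem ht), normalize_smul_of_pos ht,
      hS.normalize_smul_base ht, hS.norm_smul_base ht, norm_smul_of_nonneg ht.le, mul_comm ‖x‖ t,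
      mul_div_mul_comm, mul_div_mul_comm]
  · rw [hprod x hx, mul_eq_zero_iff_left (hKl x hx).ne', div_eq_zero_iff, or_iff_left hlame.ne']

end SlowVariation

end Cone

section Orthant

variable {d : ℕ}

lemma isBasedCone_orthant (hd : 1 ≤ d) : IsBasedCone (orthant d) (diagDir d) where
  smul_mem x hx t ht i := mul_pos ht (hx i)
  zero_notMem h := lt_irrefl 0 (h ⟨0, hd⟩)
  base_mem i := inv_pos.2 (Real.sqrt_pos.2 (Nat.cast_pos.2 hd))
  norm_base := by
    have hd0 : (d : ℝ) ≠ 0 := Nat.cast_ne_zero.2 (Nat.one_le_iff_ne_zero.1 hd)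
    simp [EuclideanSpace.norm_eq, diagDir, hd0]

lemma HasExpIntegralRep.isAsymptoticallyRadial (hd : 1 ≤ d) {K : EuclideanSpace ℝ (Fin d) → ℝ}
    (hK : HasExpIntegralRep K) : IsAsymptoticallyRadial (orthant d) (diagDir d) K := by
  obtain ⟨a, C, η, ε, -, hη, hε, hint, hKeq⟩ := hK
  have hε0 : Tendsto ε atTop (𝓝 0) := (isLittleO_one_iff ℝ).1 (by simpa using hε 0 le_rfl)
  exact isAsymptoticallyRadial_of_eq_exp_add_integral (isBasedCone_orthant hd) hη hε0 hint hKeq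

lemma hasExpIntegralRep_exp {η : EuclideanSpace ℝ (Fin d) → ℝ} {C : ℝ}
    (hη : ∀ x ∈ orthant d, Tendsto (fun t : ℝ => η (t • x)) atTop (𝓝 C)) :
    HasExpIntegralRep fun x => Real.exp (η x) :=
  ⟨1, C, η, 0, one_pos, hη, fun _ _ => isLittleO_zero _ _, by simp, by simp⟩

end Orthant

end RadialVariation

theorem mainTheorem8_general {E : Type*} [NormedAddCommGroup E] [NormedSpace ℝ E]
    [MeasurableSpace E] [BorelSpace E] {S : Set E} {e : E}
    (hS : RadialVariation.IsBasedCone S e) :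
    (∀ f : E → ℝ, RadialVariation.IsRadiallyRegularlyVaryingOn S e f →
      ∃ (ρ : ℝ) (L : E → ℝ),
        RadialVariation.IsRadiallySlowlyVaryingOn S e L ∧ ∀ x ∈ S, f x = ‖x‖ ^ ρ * L x) ∧
    (∀ L : E → ℝ, Measurable (S.domRestrict L) →
      List.TFAE [
        RadialVariation.IsRadiallySlowlyVaryingOn S e L,
        ∃ (η : E → ℝ) (l : ℝ → ℝ) (lam : E → ℝ),
          (∀ x ∈ S, Tendsto (fun t : ℝ => η (t • x)) atTop (𝓝 0)) ∧
          RadialVariation.IsRadialFactorization S e L (fun x => Real.exp (η x)) l lam,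
        ∃ (K : E → ℝ) (l : ℝ → ℝ) (lam : E → ℝ),
          RadialVariation.IsAsymptoticallyRadial S e K ∧
          RadialVariation.IsRadialFactorization S e L K l lam]) := by
  refine ⟨fun f hf => hf.exists_eq_rpow_mul hS, fun L hL => ?_⟩
  tfae_have 1 → 2 := fun h => h.exists_isRadialFactorization_exp hS
  tfae_have 2 → 3 := fun ⟨_, l, lam, hη, hfact⟩ =>
    ⟨_, l, lam, RadialVariation.isAsymptoticallyRadial_exp hS hη, hfact⟩
  tfae_have 3 → 1 := fun ⟨_, _, _, hK, hfact⟩ => hfact.isRadiallySlowlyVaryingOn hS hL hK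
  tfae_finish

theorem mainTheorem8 (d : ℕ) (hd : 1 ≤ d) :
    (∀ f : EuclideanSpace ℝ (Fin d) → ℝ, RadialVariation.IsRadiallyRegularlyVarying f →
      ∃ (ρ : ℝ) (L : EuclideanSpace ℝ (Fin d) → ℝ),
        RadialVariation.IsRadiallySlowlyVarying L ∧
        ∀ x ∈ RadialVariation.orthant d, f x = ‖x‖ ^ ρ * L x) ∧
    (∀ L : EuclideanSpace ℝ (Fin d) → ℝ,
      Measurable ((RadialVariation.orthant d).domRestrict L) →
      (RadialVariation.IsRadiallySlowlyVarying L ↔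
        ∃ (K : EuclideanSpace ℝ (Fin d) → ℝ) (l : ℝ → ℝ) (lam : EuclideanSpace ℝ (Fin d) → ℝ),
          RadialVariation.HasExpIntegralRep K ∧
          RadialVariation.IsSlowlyVarying l ∧
          (∀ a ∈ RadialVariation.spherePart d, 0 ≤ lam a) ∧
          0 < lam (RadialVariation.diagDir d) ∧
          ∀ x ∈ RadialVariation.orthant d,
            L x = K x * l ‖x‖ * lam (RadialVariation.dir x))) := by
  obtain ⟨hregular, hslow⟩ := mainTheorem8_general (RadialVariation.isBasedCone_orthant hd)
  refine ⟨hregular, fun L hL => ⟨fun h => ?_, fun ⟨K, l, lam, hK, hfact⟩ => ?_⟩⟩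
  · obtain ⟨η, l, lam, hη, hfact⟩ := ((hslow L hL).out 0 1).1 h
    exact ⟨_, l, lam, RadialVariation.hasExpIntegralRep_exp hη, hfact⟩
  · have hslowly_iff := (hslow L hL).out 0 2
    exact hslowly_iff.2 ⟨K, l, lam, hK.isAsymptoticallyRadial hd, hfact⟩
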